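/- Identify $\mathbb R^2$ with $\mathbb C$; let $B$ be the open unit disc, $S^1=\partial B$, and let $k\ge 1$ be an integer. A density on $B$ is a function $f\in L^1(B)$ with $f\ge 0$ a.e. and $\int_B f\,dx=1$. For $\delta>0$ and a density $f$ set $$J_{k,\delta}(f)=\sup_{x_1,\dots,x_k\neq 0}\ \int_{B\cap\bigcup_{i=1}^k B_{\delta|x_i|}(x_i)} f\,dx ,$$ where $x_1,\dots,x_k$ range over $\mathbb C\setminus\{0\}$ and $B_r(p)$ is the open disc of centre $p$ and radius $r$. For probability measures $\mu,\nu$ on a set $K\subseteq\mathbb C$ let $d_{KR}(\mu,\nu)=\sup_\varphi\left|\int_K\varphi\,d\mu-\int_K\varphi\,d\nu\right|$, the supremum being over the real functions $\varphi$ on $K$ with Lipschitz constant at most $1$. Let $(S^1)_k$ be the set of measures $\sum_{i=1}^k t_i\delta_{\theta_i}$ with $\theta_i\in S^1$, $t_i\ge0$, $\sum_i t_i=1$; for a probability measure $\sigma$ on $S^1$ let $F_k(\sigma)=\left(\int_{S^1}z\,d\sigma,\dots,\int_{S^1}z^k\,d\sigma\right)\in\mathbb C^k$, and let $\mathcal S_k=F_k((S^1)_k)$.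 For a density $f$ let $\mu_f$ be the probability measure on $S^1$ that is the image of $f\,dx$ under $z\mapsto z/|z|$. **Proposition 3.1.** There are constants $\delta_k,\tau_k>0$, depending only on $k$, such that for every $0<\delta\le\delta_k$ there is a map $$\Xi_k:\{f \text{ density on } B:\ J_{k,\delta}(f)>1-\tau_k\}\to\mathcal S_k$$ with the following properties. 1. $\Xi_k$ is continuous with respect to the distance $d_{KR}(f\,dx,g\,dx)$ on $\overline B$. 2. If $f_n$ are in the domain of $\Xi_k$, $\sigma\in(S^1)_k$ and $d_{KR}(f_n\,dx,\sigma)\to0$ on $\overline B$, then $\Xi_k(f_n)\to F_k(\sigma)$. 3. The same conclusion holds if only the angular measures converge, that is, if $d_{KR}(\mu_{f_n},\sigma)\to 0$ on $S^1$. -/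

import Mathlib

open MeasureTheory Filter Topology

noncomputable section

/-- The Kantorovich–Rubinstein distance between two probability measures carried by a set `K` of the
plane `ℂ = ℝ²`: the supremum of `|∫ φ dμ - ∫ φ dν|` over all real functions `φ` on `K` with Lipschitz
constant at most `1`. -/
def kantorovichRubinsteinDist (K : Set ℂ) (μ ν : Measure ℂ) : ℝ :=
  sSup {r : ℝ | ∃ φ : ℂ → ℝ, LipschitzOnWith 1 φ K ∧
    r = |(∫ x in K, φ x ∂μ) - ∫ x in K, φ x ∂ν|}

/-- `f` is (the density of) a probability measure on the unit disc `B`: it is integrable on `B`,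
nonnegative almost everywhere there, and has integral `1`. Values outside `B` play no role. -/
def IsDiscDensity (f : ℂ → ℝ) : Prop :=
  IntegrableOn f (Metric.ball 0 1) ∧
  (∀ᵐ x ∂(volume.restrict (Metric.ball (0 : ℂ) 1)), 0 ≤ f x) ∧
  ∫ x in Metric.ball (0 : ℂ) 1, f x = 1

/-- The measure `f dx` on the unit disc `B`. -/
def discMeasure (f : ℂ → ℝ) : Measure ℂ :=
  (volume.restrict (Metric.ball (0 : ℂ) 1)).withDensity (fun x => ENNReal.ofReal (f x))

/-- The angular measure of `f dx` on the unit circle, giving to a subset `A` of the circle the mass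
`∫ f dx` of the cone `⋃_{0 < t ≤ 1} t A`; that is, the image of `f dx` under `z ↦ z / |z|`. -/
def angularMeasure (f : ℂ → ℝ) : Measure ℂ :=
  (discMeasure f).map (fun z => z / (‖z‖ : ℂ))

/-- The concentration functional `J_{k,δ}(f)`: the supremum, over `k` nonzero points `x₁, …, x_k`, of
the integral of `f` over the part in `B` of the union of the discs of centre `xᵢ` and radius
`δ |xᵢ|`. -/
def concentrationJ (k : ℕ) (δ : ℝ) (f : ℂ → ℝ) : ℝ :=
  ⨆ x : {x : Fin k → ℂ // ∀ i, x i ≠ 0},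
    ∫ y in (⋃ i, Metric.ball (x.1 i) (δ * ‖x.1 i‖)) ∩ Metric.ball 0 1, f y

/-- The probability densities `f` on `B` with `J_{k,δ}(f) > 1 - τ`. -/
def concentratedDensities (k : ℕ) (δ τ : ℝ) : Set (ℂ → ℝ) :=
  {f | IsDiscDensity f ∧ 1 - τ < concentrationJ k δ f}

/-- The formal barycenters `(S¹)_k` of order `k` of the unit circle: the measures `∑ tᵢ δ_{θᵢ}` with
`θᵢ` on the unit circle, `tᵢ ≥ 0` and `∑ tᵢ = 1`. -/
def circleBarycenters (k : ℕ) : Set (Measure ℂ) :=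
  {σ | ∃ (t : Fin k → ℝ) (θ : Fin k → ℂ), (∀ i, 0 ≤ t i) ∧ ∑ i, t i = 1 ∧
    (∀ i, θ i ∈ Metric.sphere (0 : ℂ) 1) ∧
    σ = ∑ i, ENNReal.ofReal (t i) • Measure.dirac (θ i)}

/-- The moment map `F_k(σ) = (∫ z dσ, ∫ z² dσ, …, ∫ zᵏ dσ)`, integrals over the unit circle. -/
def circleMoments (k : ℕ) (σ : Measure ℂ) : Fin k → ℂ :=
  fun j => ∫ z in Metric.sphere (0 : ℂ) 1, z ^ (j.val + 1) ∂σ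

/-- The set `𝒮_k = F_k((S¹)_k)` in `ℂᵏ`. -/
def momentSphere (k : ℕ) : Set (Fin k → ℂ) :=
  circleMoments k '' circleBarycenters k

end

/-!
The map is `Ξ(f) = R(m(f))`, where `m(f)` is the vector of the first `k` moments of the angular measure
of `f` and `R` is the radial projection from the origin to the boundary of the convex hull `C` of the
moment curve `z ↦ (z, z², …, zᵏ)`, `|z| = 1`.

The set `𝒮_k` is exactly the boundary of `C`. A supporting functional at a boundary point is a
trigonometric polynomial of degree at most `k` that is nonnegative on the circle; its zeros there are
double, so there are at most `k` of them, and the boundary point is a convex combination of the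
corresponding points of the curve (`exists_of_gauge_momentBody_eq_one`). Conversely, for points
`θ₁, …, θₖ` of the circle the function `∏ |z - θᵢ|²` equals `A + L(z, …, zᵏ)` on the circle, with `L` real
linear and `A ≥ 1`, and `A + L` separates combinations of the `θᵢ` from the interior of `C`
(`gauge_momentBody_eq_one`). As `C` is a convex neighbourhood of the origin
(`momentBody_mem_nhds_zero`), its Minkowski functional is continuous and `R` is continuous away from the
origin and the identity on `𝒮_k`.

The vector `m(f)` does not vanish on the domain: if `f` is concentrated near `k` directions `θᵢ`, the
integral of `∏ |z - θᵢ|²` against the angular measure is less than `1`, whereas it would be `A ≥ 1` if all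
moments were zero (`circleMoments_ne_zero`). This fixes `δ_k` and `τ_k`.

Finally `m` is continuous. For the angular measures this holds because `zʲ` is Lipschitz on the circle.
On the disc `(z / |z|)ʲ` is discontinuous at the origin, but the limit measures (densities, or measures on
the circle) do not charge the origin, and a cutoff near it suffices (`tendsto_angular_moment`).
-/

/-! ### Convex hulls in finite dimension -/

/-- A point of the convex hull of a finite set of at most `n` points is a convex combination of an
`n`-tuple of points of that set, repetitions allowed. -/
lemma exists_fin_convexCombination {E : Type*} [AddCommGroup E] [Module ℝ E]
    {s : Finset E} {n : ℕ} (hn : s.card ≤ n) {x : E} (hx : x ∈ convexHull ℝ (s : Set E)) :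
    ∃ (w : Fin n → ℝ) (p : Fin n → E), (∀ i, 0 ≤ w i) ∧ ∑ i, w i = 1 ∧ (∀ i, p i ∈ s) ∧
      ∑ i, w i • p i = x := by
  classical
  obtain ⟨v, hv0, hv1, hvx⟩ := Finset.mem_convexHull'.1 hx
  obtain ⟨y₀, hy₀⟩ : s.Nonempty := by
    by_contra h
    rw [Finset.not_nonempty_iff_eq_empty] at h
    simp [h] at hv1
  obtain ⟨e⟩ : Nonempty (s ↪ Fin n) :=
    Function.Embedding.nonempty_of_card_le (by simpa using hn)
  have hw (y : s) : Function.extend e (fun y : s => v y) 0 (e y) = v y :=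
    e.injective.extend_apply _ _ _
  have hp (y : s) : Function.extend e (fun y : s => (y : E)) (fun _ => y₀) (e y) = y :=
    e.injective.extend_apply _ _ _
  have hw0 (i : Fin n) (hi : i ∉ Set.range e) :
      Function.extend e (fun y : s => v y) 0 i = 0 :=
    Function.extend_apply' _ _ _ (by simpa using hi)
  refine ⟨Function.extend e (fun y : s => v y) 0, Function.extend e (fun y : s => (y : E))
    (fun _ => y₀), fun i => ?_, ?_, fun i => ?_, ?_⟩
  · by_cases hi : i ∈ Set.range e
    · obtain ⟨y, rfl⟩ := hi
      rw [hw]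
      exact hv0 _ y.2
    · rw [hw0 i hi]
  · rw [← hv1, ← Finset.sum_coe_sort s]
    exact (Fintype.sum_of_injective e e.injective _ _ hw0 fun y => (hw y).symm).symm
  · by_cases hi : i ∈ Set.range e
    · obtain ⟨y, rfl⟩ := hi
      rw [hp]
      exact y.2
    · rw [Function.extend_apply' _ _ _ (by simpa using hi)]
      exact hy₀
  · rw [← hvx, ← Finset.sum_coe_sort s]
    refine (Fintype.sum_of_injective e e.injective _ _ (fun i hi => ?_) fun y => ?_).symm
    · rw [hw0 i hi, zero_smul]
    · rw [hw, hp]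

/-- In finite dimension the convex hull of a compact set is compact: by Carathéodory's theorem it is
the image of a simplex times a power of the set. -/
lemma isCompact_convexHull_of_finiteDimensional {E : Type*} [NormedAddCommGroup E]
    [NormedSpace ℝ E] [FiniteDimensional ℝ E] {s : Set E} (hs : IsCompact s) :
    IsCompact (convexHull ℝ s) := by
  let n := Module.finrank ℝ E + 1
  have key : convexHull ℝ s = (fun q : (Fin n → ℝ) × (Fin n → E) => ∑ i, q.1 i • q.2 i) ''
      (stdSimplex ℝ (Fin n) ×ˢ Set.pi Set.univ fun _ => s) := by
    apply Set.Subset.antisymm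
    · intro x hx
      rw [convexHull_eq_union] at hx
      simp only [Set.mem_iUnion] at hx
      obtain ⟨t, hts, hai, hxt⟩ := hx
      have hcard : t.card ≤ n := by
        have := hai.card_le_finrank_succ
        simp only [Fintype.card_coe] at this
        exact this.trans (Nat.succ_le_succ (Submodule.finrank_le _))
      obtain ⟨w, p, hw0, hw1, hp, rfl⟩ := exists_fin_convexCombination hcard hxt
      exact ⟨(w, p), ⟨⟨hw0, hw1⟩, fun i _ => hts (hp i)⟩, rfl⟩
    · rintro _ ⟨⟨w, p⟩, ⟨hw, hp⟩, rfl⟩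
      exact (convex_convexHull ℝ s).sum_mem (fun i _ => hw.1 i) hw.2
        fun i _ => subset_convexHull ℝ s (hp i trivial)
  rw [key]
  refine ((isCompact_stdSimplex ℝ (Fin n)).prod (isCompact_univ_pi fun _ => hs)).image ?_
  fun_prop

/-- If a linear functional is bounded by `M` on `s` and attains the value `M` at a point of the convex
hull, then this point is a convex combination of points of `s` at which the value is `M`. -/
lemma mem_convexHull_face {E : Type*} [AddCommGroup E] [Module ℝ E] {s : Set E} (l : E →ₗ[ℝ] ℝ)
    {M : ℝ} (hl : ∀ x ∈ s, l x ≤ M) {x : E} (hx : x ∈ convexHull ℝ s) (hxM : l x = M) :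
    x ∈ convexHull ℝ {y ∈ s | l y = M} := by
  classical
  obtain ⟨ι, _, w, z, hw0, hw1, hz, rfl⟩ := mem_convexHull_iff_exists_fintype.1 hx
  have h0 : ∑ i, w i * (M - l (z i)) = 0 := by
    simp only [map_sum, map_smul, smul_eq_mul] at hxM
    simp only [mul_sub, Finset.sum_sub_distrib, ← Finset.sum_mul, hw1, hxM]
    ring
  have h1 := (Finset.sum_eq_zero_iff_of_nonneg fun i _ =>
    mul_nonneg (hw0 i) (sub_nonneg.2 (hl _ (hz i)))).1 h0
  rw [← Finset.sum_subset (Finset.filter_subset (fun i => w i ≠ 0) Finset.univ)]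
  · refine (convex_convexHull ℝ _).sum_mem (fun i _ => hw0 i) ?_ fun i hi => ?_
    · rw [Finset.sum_filter_ne_zero, hw1]
    · refine subset_convexHull ℝ _ ⟨hz i, ?_⟩
      have := (mul_eq_zero.1 (h1 i (Finset.mem_univ i))).resolve_left (Finset.mem_filter.1 hi).2
      linarith
  · intro i _ hi
    have : w i = 0 := by simpa using hi
    rw [this, zero_smul]

/-! ### The moment curve and its convex hull -/

/-- The moment curve `z ↦ (z, z², …, zᵏ)`. -/
def momentCurve (k : ℕ) (z : ℂ) : Fin k → ℂ := fun j => z ^ (j.val + 1)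

/-- The convex hull of the moment curve over the unit circle. -/
def momentBody (k : ℕ) : Set (Fin k → ℂ) :=
  convexHull ℝ (momentCurve k '' Metric.sphere (0 : ℂ) 1)

lemma continuous_momentCurve (k : ℕ) : Continuous (momentCurve k) := by
  unfold momentCurve
  fun_prop

lemma convex_momentBody (k : ℕ) : Convex ℝ (momentBody k) := convex_convexHull ℝ _

lemma isCompact_momentBody (k : ℕ) : IsCompact (momentBody k) :=
  isCompact_convexHull_of_finiteDimensional
    ((isCompact_sphere (0 : ℂ) 1).image (continuous_momentCurve k))

lemma sum_pow_primitiveRoot {N : ℕ} {ζ : ℂ} (hζ : IsPrimitiveRoot ζ N) (n : ℕ) :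
    ∑ m ∈ Finset.range N, (ζ ^ m) ^ n = if N ∣ n then (N : ℂ) else 0 := by
  have hcomm (m : ℕ) : (ζ ^ m) ^ n = (ζ ^ n) ^ m := by rw [← pow_mul, ← pow_mul, mul_comm]
  simp only [hcomm]
  split_ifs with h
  · rw [(hζ.pow_eq_one_iff_dvd n).2 h]
    simp
  · have h1 : ζ ^ n ≠ 1 := fun h1 => h ((hζ.pow_eq_one_iff_dvd n).1 h1)
    rw [geom_sum_eq h1, ← hcomm N, hζ.pow_eq_one, one_pow, sub_self, zero_div]

/-- A small vector `c` is the moment vector of the probability measure that has the density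
`1 + 2 Re ∑ cⱼ z⁻ʲ` with respect to the uniform measure on the roots of unity of order `2k + 1`;
this order exceeds all frequencies that occur. -/
lemma momentBody_mem_nhds_zero (k : ℕ) : momentBody k ∈ 𝓝 (0 : Fin k → ℂ) := by
  have hr : (0 : ℝ) < 1 / (2 * k + 1) := by positivity
  refine Filter.mem_of_superset (Metric.ball_mem_nhds 0 hr) fun c hc => ?_
  rw [mem_ball_zero_iff] at hc
  let N := 2 * k + 1
  have hN : N ≠ 0 := Nat.succ_ne_zero _
  have hNC : (N : ℂ) ≠ 0 := Nat.cast_ne_zero.2 hN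
  obtain ⟨ζ, hζ⟩ : ∃ ζ : ℂ, IsPrimitiveRoot ζ N := ⟨_, Complex.isPrimitiveRoot_exp N hN⟩
  have hζn (m : ℕ) : ‖ζ ^ m‖ = 1 := by rw [norm_pow, hζ.norm'_eq_one hN, one_pow]
  have hζN (m : ℕ) : (ζ ^ m) ^ N = 1 := by rw [← pow_mul, mul_comm, pow_mul, hζ.pow_eq_one, one_pow]
  let w : ℕ → ℝ := fun m => (1 + ∑ j, 2 * (c j * (ζ ^ m) ^ (N - (j.val + 1))).re) / N
  have hconj (m : ℕ) (j : Fin k) :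
      starRingEnd ℂ ((ζ ^ m) ^ (N - (j.val + 1))) = (ζ ^ m) ^ (j.val + 1) := by
    have h1 : (ζ ^ m) ^ (N - (j.val + 1)) * (ζ ^ m) ^ (j.val + 1) = 1 := by
      rw [← pow_add, Nat.sub_add_cancel (by have := j.2; omega), hζN]
    rw [← Complex.inv_eq_conj (by rw [norm_pow, hζn, one_pow])]
    exact inv_eq_of_mul_eq_one_right h1
  have hwC (m : ℕ) : (w m : ℂ) = (1 + ∑ j, (c j * (ζ ^ m) ^ (N - (j.val + 1)) +
      starRingEnd ℂ (c j) * (ζ ^ m) ^ (j.val + 1))) / N := by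
    simp only [w]
    push_cast
    congr 2
    refine Finset.sum_congr rfl fun j _ => ?_
    rw [← hconj m j, ← map_mul, Complex.add_conj]
    push_cast
    rfl
  have hw0 (m : ℕ) : 0 ≤ w m := by
    refine div_nonneg ?_ (Nat.cast_nonneg N)
    have h1 : |∑ j, 2 * (c j * (ζ ^ m) ^ (N - (j.val + 1))).re| ≤ 1 := by
      calc |∑ j, 2 * (c j * (ζ ^ m) ^ (N - (j.val + 1))).re|
          ≤ ∑ j : Fin k, |2 * (c j * (ζ ^ m) ^ (N - (j.val + 1))).re| :=
            Finset.abs_sum_le_sum_abs _ _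
        _ ≤ ∑ _j : Fin k, 2 * (1 / (2 * k + 1) : ℝ) := by
            refine Finset.sum_le_sum fun j _ => ?_
            rw [abs_mul, abs_two]
            refine mul_le_mul_of_nonneg_left ?_ zero_le_two
            refine (Complex.abs_re_le_norm _).trans ?_
            rw [norm_mul, norm_pow, hζn, one_pow, mul_one]
            exact (norm_le_pi_norm c j).trans hc.le
        _ = 2 * k / (2 * k + 1) := by
            rw [Finset.sum_const, Finset.card_univ, Fintype.card_fin, nsmul_eq_mul]
            ring
        _ ≤ 1 := by
            rw [div_le_one (by positivity)]
            linarith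
    linarith [neg_abs_le (∑ j, 2 * (c j * (ζ ^ m) ^ (N - (j.val + 1))).re)]
  -- the moment of order `n` of the weighted roots of unity, for a general exponent `n`
  have hmom (n : ℕ) : ∑ m ∈ Finset.range N, (w m : ℂ) * (ζ ^ m) ^ n =
      ((if N ∣ n then (N : ℂ) else 0) + ∑ j : Fin k, (c j *
        (if N ∣ N - (j.val + 1) + n then (N : ℂ) else 0) +
        starRingEnd ℂ (c j) * (if N ∣ j.val + 1 + n then (N : ℂ) else 0))) / N := by
    have h1 (m : ℕ) : (w m : ℂ) * (ζ ^ m) ^ n = ((ζ ^ m) ^ n + ∑ j : Fin k,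
        (c j * (ζ ^ m) ^ (N - (j.val + 1) + n) +
          starRingEnd ℂ (c j) * (ζ ^ m) ^ (j.val + 1 + n))) / N := by
      rw [hwC, div_mul_eq_mul_div, add_mul, one_mul, Finset.sum_mul]
      congr 2
      refine Finset.sum_congr rfl fun j _ => ?_
      rw [pow_add, pow_add _ _ n]
      ring
    simp only [h1]
    rw [← Finset.sum_div, Finset.sum_add_distrib, sum_pow_primitiveRoot hζ, Finset.sum_comm]
    simp only [Finset.sum_add_distrib, ← Finset.mul_sum, sum_pow_primitiveRoot hζ]
  have hw1 : ∑ m ∈ Finset.range N, w m = 1 := by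
    have h := hmom 0
    simp only [pow_zero, mul_one, dvd_zero, if_true] at h
    have hz : ∀ j : Fin k, ¬ N ∣ N - (j.val + 1) ∧ ¬ N ∣ j.val + 1 := fun j =>
      ⟨Nat.not_dvd_of_pos_of_lt (by have := j.2; omega) (by have := j.2; omega),
        Nat.not_dvd_of_pos_of_lt (by omega) (by have := j.2; omega)⟩
    simp only [add_zero, (hz _).1, (hz _).2, if_false, mul_zero, Finset.sum_const_zero] at h
    rw [div_self hNC] at h
    exact_mod_cast h
  have hwc : ∑ m ∈ Finset.range N, w m • momentCurve k (ζ ^ m) = c := by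
    ext l
    have h := hmom (l.val + 1)
    have hl := l.2
    have h1 : ¬ N ∣ l.val + 1 := Nat.not_dvd_of_pos_of_lt (by omega) (by omega)
    have h2 (j : Fin k) : ¬ N ∣ j.val + 1 + (l.val + 1) :=
      Nat.not_dvd_of_pos_of_lt (by omega) (by have := j.2; omega)
    have h3 (j : Fin k) : N ∣ N - (j.val + 1) + (l.val + 1) ↔ j = l := by
      have hj := j.2
      constructor
      · rintro ⟨d, hd⟩
        have hd1 : d = 1 := by
          have hlt : N * d < N * 2 := by omega
          have hpos : 0 < N * d := by omega
          have := Nat.lt_of_mul_lt_mul_left hlt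
          have := Nat.pos_of_mul_pos_left hpos
          omega
        subst hd1
        ext
        omega
      · rintro rfl
        exact ⟨1, by omega⟩
    simp only [h1, h2, h3, if_false, mul_zero, add_zero, zero_add, mul_ite, Finset.sum_ite_eq',
      Finset.mem_univ, if_true] at h
    rw [mul_div_assoc, div_self hNC, mul_one] at h
    rw [← h, Finset.sum_apply]
    exact Finset.sum_congr rfl fun m _ => by simp [momentCurve]
  rw [← hwc]
  exact (convex_momentBody k).sum_mem (fun m _ => hw0 m) hw1 fun m _ =>
    subset_convexHull ℝ _ ⟨ζ ^ m, by simpa using hζn m, rfl⟩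

lemma apply_momentCurve {k : ℕ} (l : StrongDual ℂ (Fin k → ℂ)) (z : ℂ) :
    l (momentCurve k z) = ∑ j : Fin k, l (Pi.single j 1) * z ^ (j.val + 1) := by
  have h : momentCurve k z = ∑ j : Fin k, z ^ (j.val + 1) • (Pi.single j (1 : ℂ) : Fin k → ℂ) := by
    ext i
    simp [momentCurve, Finset.sum_apply, Pi.single_apply]
  rw [h, map_sum]
  simp [mul_comm]

open Polynomial in
/-- A trigonometric polynomial `M - Re ∑ aⱼ zʲ` of degree at most `k` that is nonnegative on the circle
has at most `k` zeros there: each is a minimum, hence a double root of an associated algebraic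
polynomial of degree at most `2k`, which does not vanish because its middle coefficient is `M`. -/
lemma exists_finset_contact {k : ℕ} (l : StrongDual ℂ (Fin k → ℂ)) {M : ℝ} (hM : 0 < M)
    (hl : ∀ z : ℂ, ‖z‖ = 1 → (l (momentCurve k z)).re ≤ M) :
    ∃ T : Finset ℂ, T.card ≤ k ∧
      ∀ z, z ∈ T ↔ ‖z‖ = 1 ∧ (l (momentCurve k z)).re = M := by
  classical
  let a : Fin k → ℂ := fun j => l (Pi.single j 1)
  let q : ℂ[X] := C (M : ℂ) * X ^ k - ∑ j : Fin k, (C (a j / 2) * X ^ (k + j.val + 1) +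
    C (starRingEnd ℂ (a j) / 2) * X ^ (k - (j.val + 1)))
  have hq0 : q ≠ 0 := by
    intro h
    have hc : q.coeff k = M := by
      simp only [q, coeff_sub, finsetSum_coeff, coeff_add, coeff_C_mul, coeff_X_pow, if_true,
        mul_one]
      rw [Finset.sum_eq_zero, sub_zero]
      intro j _
      have hj := j.2
      rw [if_neg (by omega), if_neg (by omega)]
      simp
    rw [h, coeff_zero] at hc
    exact hM.ne (by exact_mod_cast hc)
  have hdeg : q.natDegree ≤ 2 * k := by
    have h0 : (C (M : ℂ) * X ^ k).natDegree ≤ 2 * k :=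
      (natDegree_C_mul_X_pow_le _ _).trans (by omega)
    refine (natDegree_sub_le _ _).trans (max_le h0 ?_)
    refine natDegree_sum_le_of_forall_le _ _ fun j _ => ?_
    have hj := j.2
    have h1 : k + j.val + 1 ≤ 2 * k := by omega
    have h2 : k - (j.val + 1) ≤ 2 * k := by omega
    exact natDegree_add_le_of_degree_le ((natDegree_C_mul_X_pow_le _ _).trans h1)
      ((natDegree_C_mul_X_pow_le _ _).trans h2)
  have hq (z : ℂ) (hz : ‖z‖ = 1) :
      q.eval z = z ^ k * ((M - (l (momentCurve k z)).re : ℝ) : ℂ) := by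
    have hz0 : z ≠ 0 := norm_ne_zero_iff.1 (by rw [hz]; exact one_ne_zero)
    rw [apply_momentCurve, Complex.re_sum]
    push_cast
    simp only [q, eval_sub, eval_finsetSum, eval_add, eval_mul, eval_C, eval_pow, eval_X]
    rw [mul_sub, Finset.mul_sum, mul_comm]
    congr 1
    refine Finset.sum_congr rfl fun j _ => ?_
    have hj := j.2
    have h1 : z ^ (k - (j.val + 1)) = z ^ k * starRingEnd ℂ (z ^ (j.val + 1)) := by
      rw [← Complex.inv_eq_conj (by rw [norm_pow, hz, one_pow]), pow_sub₀ _ hz0 (by omega)]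
    rw [Complex.re_eq_add_conj, map_mul, h1]
    simp only [a]
    ring
  have hroot (z : ℂ) (hz : ‖z‖ = 1) (hzM : (l (momentCurve k z)).re = M) :
      1 < q.rootMultiplicity z := by
    have hqz : q.eval z = 0 := by rw [hq z hz, hzM, sub_self, Complex.ofReal_zero, mul_zero]
    rw [one_lt_rootMultiplicity_iff_isRoot hq0]
    refine ⟨hqz, ?_⟩
    -- differentiate `e^{-ikt} q(e^{it}) = M - Re l(γ(e^{it}))` at the minimum on the circle
    obtain ⟨t, ht⟩ : ∃ t : ℝ, Complex.exp (t * Complex.I) = z :=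
      ⟨Complex.arg z, by simpa [hz] using Complex.norm_mul_exp_arg_mul_I z⟩
    let u : ℝ → ℂ := fun s => Complex.exp (s * Complex.I)
    have hu (s : ℝ) : ‖u s‖ = 1 := Complex.norm_exp_ofReal_mul_I s
    have hu' : HasDerivAt u (z * Complex.I) t := by
      have := ((Complex.ofRealCLM.hasDerivAt (x := t)).mul_const Complex.I).cexp
      simpa [u, ht] using this
    have hut : u t = z := ht
    have hz0 : z ≠ 0 := norm_ne_zero_iff.1 (by rw [hz]; exact one_ne_zero)
    let G : ℝ → ℂ := fun s => (u s)⁻¹ ^ k * q.eval (u s)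
    have hG (s : ℝ) : G s = ((M - (l (momentCurve k (u s))).re : ℝ) : ℂ) := by
      have hs0 : u s ≠ 0 := norm_ne_zero_iff.1 (by rw [hu]; exact one_ne_zero)
      simp only [G]
      rw [hq _ (hu s), ← mul_assoc, ← mul_pow, inv_mul_cancel₀ hs0, one_pow, one_mul]
    have hq' : HasDerivAt (fun s => q.eval (u s)) (q.derivative.eval z * (z * Complex.I)) t := by
      have h := q.hasDerivAt (u t)
      rw [hut] at h
      rw [← hut] at h
      have h2 := h.comp t hu'
      rw [hut] at h2
      exact h2
    have hinv : DifferentiableAt ℝ (fun s => (u s)⁻¹ ^ k) t :=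
      (hu'.differentiableAt.inv (by rw [hut]; exact hz0)).pow k
    have hG' : HasDerivAt G (z⁻¹ ^ k * (q.derivative.eval z * (z * Complex.I))) t := by
      have := hinv.hasDerivAt.mul hq'
      simp only [hut, hqz, mul_zero, zero_add] at this
      exact this
    have hre : (z⁻¹ ^ k * (q.derivative.eval z * (z * Complex.I))).re = 0 := by
      have h1 : HasDerivAt (fun s => (G s).re) _ t :=
        Complex.reCLM.hasFDerivAt.comp_hasDerivAt t hG'
      have hmin : IsLocalMin (fun s => (G s).re) t := by
        refine Filter.Eventually.of_forall fun s => ?_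
        simp only [hG, hut, hzM, sub_self, Complex.ofReal_re]
        exact sub_nonneg.2 (hl _ (hu s))
      simpa using hmin.hasDerivAt_eq_zero h1
    have him : (z⁻¹ ^ k * (q.derivative.eval z * (z * Complex.I))).im = 0 := by
      have h1 : HasDerivAt (fun s => (G s).im) _ t :=
        Complex.imCLM.hasFDerivAt.comp_hasDerivAt t hG'
      have h0 : (fun s => (G s).im) = fun _ => 0 := funext fun s => by rw [hG, Complex.ofReal_im]
      rw [h0] at h1
      simpa using h1.unique (hasDerivAt_const t (0 : ℝ))
    have h0 := Complex.ext (z := z⁻¹ ^ k * (q.derivative.eval z * (z * Complex.I))) (w := 0) hre him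
    simpa [hz0] using h0
  refine ⟨q.roots.toFinset.filter fun z => ‖z‖ = 1 ∧ (l (momentCurve k z)).re = M, ?_, fun z => ?_⟩
  · set T := q.roots.toFinset.filter fun z => ‖z‖ = 1 ∧ (l (momentCurve k z)).re = M with hT
    have h1 : T.card * 2 ≤ ∑ z ∈ T, q.roots.count z := by
      rw [← smul_eq_mul, ← Finset.sum_const]
      refine Finset.sum_le_sum fun z hz => ?_
      have hz' := (Finset.mem_filter.1 hz).2
      rw [count_roots]
      exact hroot z hz'.1 hz'.2
    have h2 : ∑ z ∈ T, q.roots.count z ≤ ∑ z ∈ q.roots.toFinset, q.roots.count z :=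
      Finset.sum_le_sum_of_subset (Finset.filter_subset _ _)
    rw [Multiset.toFinset_sum_count_eq] at h2
    have h3 := q.card_roots'
    omega
  · rw [Finset.mem_filter, Multiset.mem_toFinset, mem_roots hq0, and_iff_right_iff_imp]
    rintro ⟨hz, hzM⟩
    have := hroot z hz hzM
    exact (one_lt_rootMultiplicity_iff_isRoot hq0).1 this |>.1

/-- A point on the boundary of the convex hull of the moment curve is a convex combination of `k`
points of the curve. -/
lemma exists_of_gauge_momentBody_eq_one {k : ℕ} {c : Fin k → ℂ} (hc : gauge (momentBody k) c = 1) :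
    ∃ (t : Fin k → ℝ) (θ : Fin k → ℂ), (∀ i, 0 ≤ t i) ∧ ∑ i, t i = 1 ∧
      (∀ i, θ i ∈ Metric.sphere (0 : ℂ) 1) ∧ ∑ i, t i • momentCurve k (θ i) = c := by
  classical
  have h0 := momentBody_mem_nhds_zero k
  have hcl : IsClosed (momentBody k) := (isCompact_momentBody k).isClosed
  rw [gauge_eq_one_iff_mem_frontier (convex_momentBody k) h0, hcl.frontier_eq] at hc
  obtain ⟨l, hl⟩ := RCLike.geometric_hahn_banach_open_point (𝕜 := ℂ) (convex_momentBody k).interior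
    isOpen_interior hc.2
  have hM : 0 < (l c).re := by simpa using hl 0 (mem_interior_iff_mem_nhds.2 h0)
  have hle : ∀ x ∈ momentBody k, (l x).re ≤ (l c).re := by
    intro x hx
    have hx' : x ∈ closure (interior (momentBody k)) := by
      rw [(convex_momentBody k).closure_interior_eq_closure_of_nonempty_interior
        ⟨0, mem_interior_iff_mem_nhds.2 h0⟩]
      exact subset_closure hx
    refine closure_minimal (fun y hy => (hl y hy).le) ?_ hx'
    exact isClosed_le (Complex.continuous_re.comp l.continuous) continuous_const
  obtain ⟨T, hTk, hT⟩ := exists_finset_contact l hM fun z hz =>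
    hle _ (subset_convexHull ℝ _ ⟨z, by simpa using hz, rfl⟩)
  let lr : (Fin k → ℂ) →ₗ[ℝ] ℝ := Complex.reLm ∘ₗ (l : (Fin k → ℂ) →ₗ[ℂ] ℂ).restrictScalars ℝ
  have hface := mem_convexHull_face lr (M := (l c).re)
    (fun x hx => hle x (subset_convexHull ℝ _ hx)) hc.1 rfl
  have hsub : {y ∈ momentCurve k '' Metric.sphere (0 : ℂ) 1 | lr y = (l c).re} ⊆
      (T.image (momentCurve k) : Finset (Fin k → ℂ)) := by
    rintro _ ⟨⟨z, hz, rfl⟩, hzM⟩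
    exact Finset.mem_coe.2 (Finset.mem_image_of_mem _ ((hT z).2 ⟨by simpa using hz, hzM⟩))
  obtain ⟨t, p, ht0, ht1, hp, hpc⟩ := exists_fin_convexCombination
    (Finset.card_image_le.trans hTk) (convexHull_mono hsub hface)
  choose θ hθT hθ using fun i => Finset.mem_image.1 (hp i)
  exact ⟨t, θ, ht0, ht1, fun i => by simpa using ((hT _).1 (hθT i)).1, by simpa [hθ] using hpc⟩

/-! ### Nonnegative trigonometric polynomials -/

lemma exists_clm_re_monomial {k a b : ℕ} (ha : a ≤ k) (hb : b ≤ k) (u : ℂ) :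
    ∃ L : (Fin k → ℂ) →L[ℝ] ℝ, ∀ z : ℂ, ‖z‖ = 1 →
      (u * (z ^ a * starRingEnd ℂ (z ^ b))).re = (if a = b then u.re else 0) +
        L (momentCurve k z) := by
  have hmul (z : ℂ) (hz : ‖z‖ = 1) (m n : ℕ) :
      z ^ (m + n) * starRingEnd ℂ (z ^ m) = z ^ n := by
    rw [pow_add, mul_right_comm, Complex.mul_conj, Complex.normSq_eq_norm_sq, norm_pow, hz]
    simp
  let F (v : ℂ) (i : Fin k) : (Fin k → ℂ) →L[ℝ] ℝ :=
    Complex.reCLM.comp ((ContinuousLinearMap.mul ℝ ℂ v).comp (ContinuousLinearMap.proj i))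
  have hF (v : ℂ) (i : Fin k) (z : ℂ) : F v i (momentCurve k z) = (v * z ^ (i.val + 1)).re := rfl
  rcases lt_trichotomy a b with h | h | h
  · refine ⟨F (starRingEnd ℂ u) ⟨b - a - 1, by omega⟩, fun z hz => ?_⟩
    have hab : b = a + (b - a - 1 + 1) := by omega
    have h1 : u * (z ^ a * starRingEnd ℂ (z ^ b)) =
        starRingEnd ℂ (starRingEnd ℂ u * z ^ (b - a - 1 + 1)) := by
      rw [← hmul z hz a (b - a - 1 + 1), ← hab]
      simp only [map_mul, Complex.conj_conj]
      ring
    rw [hF, h1, Complex.conj_re, if_neg h.ne, zero_add]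
  · subst h
    refine ⟨0, fun z hz => ?_⟩
    have := hmul z hz a 0
    rw [add_zero, pow_zero] at this
    simp only [this]
    simp
  · refine ⟨F u ⟨a - b - 1, by omega⟩, fun z hz => ?_⟩
    have hab : a = b + (a - b - 1 + 1) := by omega
    have h1 : z ^ a * starRingEnd ℂ (z ^ b) = z ^ (a - b - 1 + 1) := by
      conv_lhs => rw [hab]
      exact hmul z hz _ _
    rw [hF, h1, if_neg h.ne', zero_add]

open Polynomial in
/-- On the unit circle the squared modulus of a monic polynomial of degree at most `k` is a real affine
function of the first `k` moments. Its constant term is the sum of the squared moduli of the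
coefficients, so it is at least `1`. -/
lemma exists_affine_normSq_eval {k : ℕ} {P : ℂ[X]} (hP : P.Monic) (hk : P.natDegree ≤ k) :
    ∃ (A : ℝ) (L : (Fin k → ℂ) →L[ℝ] ℝ), 1 ≤ A ∧
      ∀ z : ℂ, ‖z‖ = 1 → ‖P.eval z‖ ^ 2 = A + L (momentCurve k z) := by
  have hex (a b : Fin (k + 1)) := exists_clm_re_monomial (Nat.lt_succ_iff.1 a.2)
    (Nat.lt_succ_iff.1 b.2) (P.coeff a * starRingEnd ℂ (P.coeff b))
  choose L hL using hex
  refine ⟨∑ a : Fin (k + 1), ‖P.coeff a‖ ^ 2, ∑ a, ∑ b, L a b, ?_, fun z hz => ?_⟩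
  · have h1 := Finset.single_le_sum (s := Finset.univ)
      (f := fun a : Fin (k + 1) => ‖P.coeff a‖ ^ 2) (fun _ _ => sq_nonneg _)
      (Finset.mem_univ ⟨P.natDegree, Nat.lt_succ_iff.2 hk⟩)
    have h2 : P.coeff P.natDegree = 1 := hP
    simpa [h2] using h1
  · have hev : P.eval z = ∑ a : Fin (k + 1), P.coeff a * z ^ (a : ℕ) := by
      rw [eval_eq_sum_range' (Nat.lt_succ_iff.2 hk), Finset.sum_range]
    have hsq : ‖P.eval z‖ ^ 2 = (P.eval z * starRingEnd ℂ (P.eval z)).re := by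
      rw [Complex.mul_conj, Complex.normSq_eq_norm_sq, Complex.ofReal_re]
    rw [hsq, hev, map_sum, Finset.sum_mul_sum, Complex.re_sum]
    simp only [Complex.re_sum, sum_apply]
    rw [← Finset.sum_add_distrib]
    refine Finset.sum_congr rfl fun a _ => ?_
    have hterm (b : Fin (k + 1)) :
        (P.coeff a * z ^ (a : ℕ) * starRingEnd ℂ (P.coeff b * z ^ (b : ℕ))).re =
        (if a = b then ‖P.coeff a‖ ^ 2 else 0) + L a b (momentCurve k z) := by
      have h := hL a b z hz
      rw [map_mul, mul_mul_mul_comm, h]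
      congr 1
      by_cases hab : a = b
      · subst hab
        rw [if_pos rfl, if_pos rfl, Complex.mul_conj, Complex.normSq_eq_norm_sq,
          Complex.ofReal_re]
      · rw [if_neg hab, if_neg (fun h => hab (Fin.ext h))]
    simp only [hterm, Finset.sum_add_distrib, Finset.sum_ite_eq, Finset.mem_univ, if_true]

open Polynomial in
/-- The polynomial with zeros `θ₁, …, θₖ`, as a real affine function of the moments. -/
lemma exists_affine_prod_norm_sub {k : ℕ} (θ : Fin k → ℂ) :
    ∃ (A : ℝ) (L : (Fin k → ℂ) →L[ℝ] ℝ), 1 ≤ A ∧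
      ∀ z : ℂ, ‖z‖ = 1 → (∏ i, ‖z - θ i‖) ^ 2 = A + L (momentCurve k z) := by
  obtain ⟨A, L, hA, hL⟩ := exists_affine_normSq_eval (k := k) (P := ∏ i, (X - C (θ i)))
    (monic_prod_of_monic _ _ fun i _ => monic_X_sub_C _)
    (by rw [natDegree_prod_of_monic _ _ fun i _ => monic_X_sub_C _]; simp)
  refine ⟨A, L, hA, fun z hz => ?_⟩
  rw [← hL z hz, eval_prod, norm_prod]
  simp

/-- A convex combination `c` of `k` points of the moment curve lies on the boundary of the convex hull:
the polynomial with zeros at these points gives an affine function that is nonnegative on the hull,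
zero at `c` and positive at the origin. -/
lemma gauge_momentBody_eq_one {k : ℕ} {t : Fin k → ℝ} {θ : Fin k → ℂ} (ht0 : ∀ i, 0 ≤ t i)
    (ht1 : ∑ i, t i = 1) (hθ : ∀ i, θ i ∈ Metric.sphere (0 : ℂ) 1) :
    gauge (momentBody k) (∑ i, t i • momentCurve k (θ i)) = 1 := by
  obtain ⟨A, L, hA, hL⟩ := exists_affine_prod_norm_sub θ
  set c := ∑ i, t i • momentCurve k (θ i) with hc
  have hLθ (i : Fin k) : L (momentCurve k (θ i)) = -A := by
    have h := hL (θ i) (by simpa using hθ i)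
    rw [Finset.prod_eq_zero (Finset.mem_univ i) (by simp)] at h
    linarith
  have hLc : L c = -A := by
    simp only [hc, map_sum, map_smul, hLθ, smul_eq_mul, ← Finset.sum_mul, ht1, one_mul]
  have hpos : ∀ x ∈ momentBody k, -A ≤ L x := by
    have hcv : Convex ℝ {x | -A ≤ L x} := convex_halfSpace_ge L.isLinear _
    refine fun x hx => convexHull_min ?_ hcv hx
    rintro _ ⟨z, hz, rfl⟩
    have h := hL z (by simpa using hz)
    have := sq_nonneg (∏ i, ‖z - θ i‖)
    simp only [Set.mem_ofPred_eq]
    linarith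
  apply le_antisymm
  · exact gauge_le_one_of_mem ((convex_momentBody k).sum_mem (fun i _ => ht0 i) ht1 fun i _ =>
      subset_convexHull ℝ _ ⟨θ i, hθ i, rfl⟩)
  · by_contra! hlt
    obtain ⟨r, hr0, hr1, x, hx, hxc⟩ :=
      exists_lt_of_gauge_lt (absorbent_nhds_zero (momentBody_mem_nhds_zero k)) hlt
    have h1 := hpos x hx
    have h2 : L c = r * L x := by
      rw [← hxc]
      simp
    nlinarith

/-! ### The Kantorovich–Rubinstein distance -/

lemma kantorovichRubinsteinDist_nonneg (K : Set ℂ) (μ ν : Measure ℂ) :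
    0 ≤ kantorovichRubinsteinDist K μ ν := by
  refine Real.sSup_nonneg ?_
  rintro _ ⟨φ, -, rfl⟩
  exact abs_nonneg _

/-- For probability measures on a compact set the set of values in the definition of the
Kantorovich–Rubinstein distance is bounded, so that the distance is a genuine supremum. -/
lemma abs_integral_sub_le_kantorovichRubinsteinDist {K : Set ℂ} (hK : IsCompact K)
    {μ ν : Measure ℂ} [IsFiniteMeasure μ] [IsFiniteMeasure ν] (hμ : μ.real K = 1)
    (hν : ν.real K = 1) {φ : ℂ → ℝ} (hφ : LipschitzOnWith 1 φ K) :
    |(∫ x in K, φ x ∂μ) - ∫ x in K, φ x ∂ν| ≤ kantorovichRubinsteinDist K μ ν := by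
  refine le_csSup ?_ ⟨φ, hφ, rfl⟩
  obtain ⟨x₀, hx₀⟩ : K.Nonempty := by
    rw [Set.nonempty_iff_ne_empty]
    rintro rfl
    simp at hμ
  have hdev (ρ : Measure ℂ) [IsFiniteMeasure ρ] (hρ : ρ.real K = 1) {ψ : ℂ → ℝ}
      (hψ : LipschitzOnWith 1 ψ K) : |(∫ x in K, ψ x ∂ρ) - ψ x₀| ≤ Metric.diam K := by
    have hint : IntegrableOn ψ K ρ := hψ.continuousOn.integrableOn_compact hK
    have h1 : (∫ x in K, ψ x ∂ρ) - ψ x₀ = ∫ x in K, (ψ x - ψ x₀) ∂ρ := by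
      rw [integral_sub hint (integrable_const _), setIntegral_const, hρ, one_smul]
    rw [h1, ← Real.norm_eq_abs]
    have h2 := norm_setIntegral_le_of_norm_le_const (μ := ρ) (s := K) (f := fun x => ψ x - ψ x₀)
      (C := Metric.diam K) (measure_lt_top ρ K) fun x hx => by
        rw [← dist_eq_norm]
        have := hψ.dist_le_mul x hx x₀ hx₀
        rw [NNReal.coe_one, one_mul] at this
        exact this.trans (Metric.dist_le_diam_of_mem hK.isBounded hx hx₀)
    rwa [hρ, mul_one] at h2
  refine ⟨Metric.diam K + Metric.diam K, ?_⟩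
  rintro _ ⟨ψ, hψ, rfl⟩
  have h1 := abs_le.1 (hdev μ hμ hψ)
  have h2 := abs_le.1 (hdev ν hν hψ)
  rw [abs_le]
  constructor <;> linarith [h1.1, h1.2, h2.1, h2.2]

lemma abs_integral_sub_le_mul_kantorovichRubinsteinDist {K : Set ℂ} (hK : IsCompact K)
    {μ ν : Measure ℂ} [IsFiniteMeasure μ] [IsFiniteMeasure ν] (hμ : μ.real K = 1)
    (hν : ν.real K = 1) {φ : ℂ → ℝ} {C : ℝ} (hC : 0 < C)
    (hφ : ∀ x ∈ K, ∀ y ∈ K, |φ x - φ y| ≤ C * ‖x - y‖) :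
    |(∫ x in K, φ x ∂μ) - ∫ x in K, φ x ∂ν| ≤ C * kantorovichRubinsteinDist K μ ν := by
  have h1 : LipschitzOnWith 1 (fun x => C⁻¹ * φ x) K := by
    refine LipschitzOnWith.of_dist_le_mul fun x hx y hy => ?_
    rw [NNReal.coe_one, one_mul, Real.dist_eq, dist_eq_norm, ← mul_sub, abs_mul,
      abs_of_pos (inv_pos.2 hC), inv_mul_le_iff₀ hC]
    exact hφ x hx y hy
  have h2 := abs_integral_sub_le_kantorovichRubinsteinDist hK hμ hν h1
  rwa [integral_const_mul, integral_const_mul, ← mul_sub, abs_mul, abs_of_pos (inv_pos.2 hC),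
    inv_mul_le_iff₀ hC] at h2

lemma norm_integral_sub_le_mul_kantorovichRubinsteinDist {K : Set ℂ} (hK : IsCompact K)
    {μ ν : Measure ℂ} [IsFiniteMeasure μ] [IsFiniteMeasure ν] (hμ : μ.real K = 1)
    (hν : ν.real K = 1) {φ : ℂ → ℂ} {C : ℝ} (hC : 0 < C)
    (hφ : ∀ x ∈ K, ∀ y ∈ K, ‖φ x - φ y‖ ≤ C * ‖x - y‖) :
    ‖(∫ x in K, φ x ∂μ) - ∫ x in K, φ x ∂ν‖ ≤ 2 * C * kantorovichRubinsteinDist K μ ν := by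
  have hcont : ContinuousOn φ K := by
    have : LipschitzOnWith C.toNNReal φ K := LipschitzOnWith.of_dist_le_mul fun x hx y hy => by
      rw [Real.coe_toNNReal _ hC.le, dist_eq_norm, dist_eq_norm]
      exact hφ x hx y hy
    exact this.continuousOn
  have hint (ρ : Measure ℂ) [IsFiniteMeasure ρ] : IntegrableOn φ K ρ :=
    hcont.integrableOn_compact hK
  have hre (ρ : Measure ℂ) [IsFiniteMeasure ρ] :
      (∫ x in K, φ x ∂ρ).re = ∫ x in K, (φ x).re ∂ρ := (integral_re (hint ρ)).symm
  have him (ρ : Measure ℂ) [IsFiniteMeasure ρ] :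
      (∫ x in K, φ x ∂ρ).im = ∫ x in K, (φ x).im ∂ρ := (integral_im (hint ρ)).symm
  have h1 := abs_integral_sub_le_mul_kantorovichRubinsteinDist hK hμ hν
    (φ := fun x => (φ x).re) hC fun x hx y hy =>
      (Complex.abs_re_le_norm (φ x - φ y)).trans (hφ x hx y hy)
  have h2 := abs_integral_sub_le_mul_kantorovichRubinsteinDist hK hμ hν
    (φ := fun x => (φ x).im) hC fun x hx y hy =>
      (Complex.abs_im_le_norm (φ x - φ y)).trans (hφ x hx y hy)
  refine (Complex.norm_le_abs_re_add_abs_im _).trans ?_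
  rw [Complex.sub_re, Complex.sub_im, hre, hre, him, him]
  linarith

/-! ### Convergence of angular moments -/

lemma norm_pow_sub_pow_le_mul {z w : ℂ} (hz : ‖z‖ ≤ 1) (hw : ‖w‖ ≤ 1) (n : ℕ) :
    ‖z ^ n - w ^ n‖ ≤ n * ‖z - w‖ := by
  induction n with
  | zero => simp
  | succ n ih =>
    have h : z ^ (n + 1) - w ^ (n + 1) = z ^ n * (z - w) + (z ^ n - w ^ n) * w := by ring
    calc ‖z ^ (n + 1) - w ^ (n + 1)‖ ≤ ‖z ^ n * (z - w)‖ + ‖(z ^ n - w ^ n) * w‖ := by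
          rw [h]
          exact norm_add_le _ _
      _ ≤ 1 * ‖z - w‖ + (n * ‖z - w‖) * 1 := by
          rw [norm_mul, norm_mul, norm_pow]
          gcongr
          exact pow_le_one₀ (norm_nonneg z) hz
      _ = (n + 1 : ℕ) * ‖z - w‖ := by
          push_cast
          ring

/-- The angular part `z / |z|`, modified near the origin so as to be Lipschitz. -/
lemma norm_div_max_sub_le {r : ℝ} (hr : 0 < r) (z w : ℂ) :
    ‖z / (max ‖z‖ r : ℝ) - w / (max ‖w‖ r : ℝ)‖ ≤ 2 / r * ‖z - w‖ := by
  set a := max ‖z‖ r with ha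
  set b := max ‖w‖ r with hb
  have har : r ≤ a := le_max_right _ _
  have hbr : r ≤ b := le_max_right _ _
  have ha0 : 0 < a := hr.trans_le har
  have hb0 : 0 < b := hr.trans_le hbr
  have hab : |b - a| ≤ ‖z - w‖ := by
    refine (abs_max_sub_max_le_abs _ _ _).trans ?_
    rw [norm_sub_rev]
    exact abs_norm_sub_norm_le w z
  have haC : (a : ℂ) ≠ 0 := Complex.ofReal_ne_zero.2 ha0.ne'
  have hbC : (b : ℂ) ≠ 0 := Complex.ofReal_ne_zero.2 hb0.ne'
  have h : z / (a : ℂ) - w / (b : ℂ) = z / a * (((b - a : ℝ) : ℂ) / b) + (z - w) / b := by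
    push_cast
    field_simp
    ring
  rw [h]
  calc ‖z / (a : ℂ) * (((b - a : ℝ) : ℂ) / b) + (z - w) / b‖
      ≤ ‖z‖ / a * (|b - a| / b) + ‖z - w‖ / b := by
        refine (norm_add_le _ _).trans_eq ?_
        simp only [norm_mul, norm_div, Complex.norm_real, Real.norm_eq_abs, abs_of_pos ha0,
          abs_of_pos hb0]
    _ ≤ 1 * (‖z - w‖ / r) + ‖z - w‖ / r := by
        gcongr
        exact (div_le_one ha0).2 (le_max_left _ _)
    _ = 2 / r * ‖z - w‖ := by ring

lemma norm_div_max_le_one {r : ℝ} (hr : 0 < r) (z : ℂ) : ‖z / (max ‖z‖ r : ℝ)‖ ≤ 1 := by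
  have ha0 : 0 < max ‖z‖ r := hr.trans_le (le_max_right _ _)
  rw [norm_div, Complex.norm_real, Real.norm_eq_abs, abs_of_pos ha0]
  exact (div_le_one ha0).2 (le_max_left _ _)

lemma norm_div_norm_le_one (z : ℂ) : ‖z / (‖z‖ : ℂ)‖ ≤ 1 := by
  rw [norm_div, Complex.norm_real, norm_norm]
  exact div_self_le_one _

lemma measurable_div_norm : Measurable fun z : ℂ => z / (‖z‖ : ℂ) :=
  measurable_id.div (Complex.measurable_ofReal.comp measurable_norm)

/-- The Lipschitz tent function `max 0 (2 - |z| / r)`, which is at least `1` for `|z| ≤ r`, controls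
the error made in replacing `(z / |z|) ^ n` by its Lipschitz modification. -/
lemma norm_angular_pow_sub_le {r : ℝ} (hr : 0 < r) (n : ℕ) (z : ℂ) :
    ‖(z / (‖z‖ : ℂ)) ^ n - (z / (max ‖z‖ r : ℝ)) ^ n‖ ≤ 2 * max 0 (2 - ‖z‖ / r) := by
  rcases le_total r ‖z‖ with h | h
  · rw [max_eq_left h, sub_self, norm_zero]
    positivity
  · have h1 : 1 ≤ max 0 (2 - ‖z‖ / r) := by
      refine le_max_of_le_right ?_
      have := (div_le_one hr).2 h
      linarith
    refine (norm_sub_le _ _).trans ?_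
    rw [norm_pow, norm_pow]
    have h2 := pow_le_one₀ (n := n) (norm_nonneg _) (norm_div_norm_le_one z)
    have h3 := pow_le_one₀ (n := n) (norm_nonneg _) (norm_div_max_le_one hr z)
    linarith

lemma abs_tent_sub_le {r : ℝ} (hr : 0 < r) (z w : ℂ) :
    |max 0 (2 - ‖z‖ / r) - max 0 (2 - ‖w‖ / r)| ≤ 1 / r * ‖z - w‖ := by
  rw [max_comm 0, max_comm 0]
  refine (abs_max_sub_max_le_abs _ _ _).trans ?_
  have h : 2 - ‖z‖ / r - (2 - ‖w‖ / r) = 1 / r * (‖w‖ - ‖z‖) := by ring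
  rw [h, abs_mul, abs_of_pos (one_div_pos.2 hr), norm_sub_rev]
  gcongr
  exact abs_norm_sub_norm_le w z

/-- If `ν` has no mass at the origin, the integrals of small tent functions are small. -/
lemma exists_integral_tent_lt {K : Set ℂ} {ν : Measure ℂ} [IsFiniteMeasure ν] (hν0 : ν {0} = 0)
    {ε : ℝ} (hε : 0 < ε) : ∃ r > 0, ∫ z in K, max 0 (2 - ‖z‖ / r) ∂ν < ε := by
  have hlim : Tendsto (fun n : ℕ => ∫ z in K, max 0 (2 - ‖z‖ / (1 / ((n : ℝ) + 1))) ∂ν) atTop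
      (𝓝 (∫ z in K, (0 : ℝ) ∂ν)) := by
    refine tendsto_integral_of_dominated_convergence (fun _ => 2) (fun n => ?_)
      (integrable_const _) (fun n => Eventually.of_forall fun z => ?_) ?_
    · exact Continuous.aestronglyMeasurable (by fun_prop)
    · rw [Real.norm_eq_abs, abs_of_nonneg (le_max_left _ _)]
      refine max_le zero_le_two ?_
      have : 0 ≤ ‖z‖ / (1 / ((n : ℝ) + 1)) := by positivity
      linarith
    · have hne : ∀ᵐ z ∂(ν.restrict K), z ≠ 0 := by
        refine ae_restrict_of_ae ?_
        rw [ae_iff]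
        simpa using hν0
      filter_upwards [hne] with z hz
      refine tendsto_const_nhds.congr' ?_
      obtain ⟨N, hN⟩ := exists_nat_gt (2 / ‖z‖)
      filter_upwards [eventually_ge_atTop N] with n hn
      have hz' : 0 < ‖z‖ := norm_pos_iff.2 hz
      have h1 : 2 < ‖z‖ * ((n : ℝ) + 1) := by
        rw [div_lt_iff₀ hz'] at hN
        have : (N : ℝ) ≤ n := Nat.cast_le.2 hn
        nlinarith
      rw [div_div_eq_mul_div, div_one, max_eq_left (by linarith)]
  rw [integral_zero] at hlim
  obtain ⟨n, hn⟩ := (hlim.eventually (gt_mem_nhds hε)).exists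
  exact ⟨1 / ((n : ℝ) + 1), by positivity, hn⟩

/-- Convergence in the Kantorovich–Rubinstein distance to a measure without mass at the origin implies
convergence of the angular moments, although `z / |z|` is discontinuous at the origin. -/
lemma tendsto_angular_moment {ι : Type*} {l : Filter ι} {K : Set ℂ} (hK : IsCompact K)
    {μ : ι → Measure ℂ} {ν : Measure ℂ} [∀ i, IsFiniteMeasure (μ i)] [IsFiniteMeasure ν]
    (hμ : ∀ i, (μ i).real K = 1) (hν : ν.real K = 1) (hν0 : ν {0} = 0)
    (h : Tendsto (fun i => kantorovichRubinsteinDist K (μ i) ν) l (𝓝 0)) (n : ℕ) :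
    Tendsto (fun i => ∫ z in K, (z / (‖z‖ : ℂ)) ^ n ∂(μ i)) l
      (𝓝 (∫ z in K, (z / (‖z‖ : ℂ)) ^ n ∂ν)) := by
  rw [Metric.tendsto_nhds]
  intro ε hε
  obtain ⟨r, hr, hrε⟩ := exists_integral_tent_lt (K := K) hν0 (show 0 < ε / 8 by positivity)
  let e : ℂ → ℂ := fun z => (z / (‖z‖ : ℂ)) ^ n
  let ψ : ℂ → ℂ := fun z => (z / (max ‖z‖ r : ℝ)) ^ n
  let χ : ℂ → ℝ := fun z => max 0 (2 - ‖z‖ / r)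
  let C : ℝ := (n + 1) * (2 / r)
  have hC : 0 < C := by positivity
  have hψ (x y : ℂ) : ‖ψ x - ψ y‖ ≤ C * ‖x - y‖ := by
    refine (norm_pow_sub_pow_le_mul (norm_div_max_le_one hr x) (norm_div_max_le_one hr y) n).trans ?_
    rw [mul_assoc]
    refine mul_le_mul (by linarith) (norm_div_max_sub_le hr x y) (norm_nonneg _) (by positivity)
  have hψc : Continuous ψ := by
    have : LipschitzWith C.toNNReal ψ := LipschitzWith.of_dist_le_mul fun x y => by
      rw [Real.coe_toNNReal _ hC.le, dist_eq_norm, dist_eq_norm]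
      exact hψ x y
    exact this.continuous
  have hχc : Continuous χ := by
    simp only [χ]
    fun_prop
  have hei (ρ : Measure ℂ) [IsFiniteMeasure ρ] : IntegrableOn e K ρ := by
    refine Integrable.of_bound (C := 1) (measurable_div_norm.pow_const n).aestronglyMeasurable
      (Eventually.of_forall fun z => ?_)
    rw [norm_pow]
    exact pow_le_one₀ (norm_nonneg _) (norm_div_norm_le_one z)
  have herr (ρ : Measure ℂ) [IsFiniteMeasure ρ] :
      ‖(∫ z in K, e z ∂ρ) - ∫ z in K, ψ z ∂ρ‖ ≤ 2 * ∫ z in K, χ z ∂ρ := by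
    rw [← integral_sub (hei ρ) (hψc.continuousOn.integrableOn_compact hK), ← integral_const_mul]
    refine norm_integral_le_of_norm_le
      ((hχc.continuousOn.integrableOn_compact hK).const_mul 2) (Eventually.of_forall fun z => ?_)
    exact norm_angular_pow_sub_le hr n z
  have hsmall : ∀ᶠ i in l, (2 / r + 2 * C) * kantorovichRubinsteinDist K (μ i) ν < ε / 2 := by
    have := h.const_mul (2 / r + 2 * C)
    rw [mul_zero] at this
    exact this.eventually (gt_mem_nhds (by positivity))
  filter_upwards [hsmall] with i hi
  have h1 := norm_integral_sub_le_mul_kantorovichRubinsteinDist hK (hμ i) hν hC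
    fun x _ y _ => hψ x y
  have h2 := (abs_le.1 (abs_integral_sub_le_mul_kantorovichRubinsteinDist hK (hμ i) hν
    (one_div_pos.2 hr) fun x _ y _ => abs_tent_sub_le hr x y)).2
  have h3 := herr (μ i)
  have h4 := herr ν
  rw [norm_sub_rev] at h4
  have h5 : ∫ z in K, χ z ∂(μ i) ≤ (∫ z in K, χ z ∂ν) +
      1 / r * kantorovichRubinsteinDist K (μ i) ν := by
    simp only [χ]
    linarith
  have hχν : ∫ z in K, χ z ∂ν < ε / 8 := hrε
  rw [dist_eq_norm]
  have htri : ‖(∫ z in K, e z ∂(μ i)) - ∫ z in K, e z ∂ν‖ ≤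
      ‖(∫ z in K, e z ∂(μ i)) - ∫ z in K, ψ z ∂(μ i)‖ +
      ‖(∫ z in K, ψ z ∂(μ i)) - ∫ z in K, ψ z ∂ν‖ +
      ‖(∫ z in K, ψ z ∂ν) - ∫ z in K, e z ∂ν‖ := by
    rw [← sub_add_sub_cancel _ (∫ z in K, ψ z ∂(μ i)) (∫ z in K, e z ∂ν),
      ← sub_add_sub_cancel (∫ z in K, ψ z ∂(μ i)) (∫ z in K, ψ z ∂ν) (∫ z in K, e z ∂ν), ← add_assoc]
    exact norm_add₃_le
  refine htri.trans_lt ?_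
  have h6 : (2 / r + 2 * C) * kantorovichRubinsteinDist K (μ i) ν =
    2 * (1 / r * kantorovichRubinsteinDist K (μ i) ν) +
      2 * C * kantorovichRubinsteinDist K (μ i) ν := by ring
  rw [h6] at hi
  have h1' : ‖(∫ z in K, ψ z ∂(μ i)) - ∫ z in K, ψ z ∂ν‖ ≤
    2 * C * kantorovichRubinsteinDist K (μ i) ν := h1
  linarith

/-! ### Formal barycenters and disc densities as measures -/

lemma integral_sum_smul_dirac {k : ℕ} {t : Fin k → ℝ} (ht : ∀ i, 0 ≤ t i) (θ : Fin k → ℂ)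
    {E : Type*} [NormedAddCommGroup E] [NormedSpace ℝ E] [CompleteSpace E] {K : Set ℂ}
    (hK : MeasurableSet K) (hθ : ∀ i, θ i ∈ K) (g : ℂ → E) :
    ∫ z in K, g z ∂(∑ i, ENNReal.ofReal (t i) • Measure.dirac (θ i)) = ∑ i, t i • g (θ i) := by
  have hres : (∑ i, ENNReal.ofReal (t i) • Measure.dirac (θ i)).restrict K =
      ∑ i, ENNReal.ofReal (t i) • Measure.dirac (θ i) := by
    refine Measure.restrict_eq_self_of_ae_mem ?_
    change (∑ i, ENNReal.ofReal (t i) • Measure.dirac (θ i)) Kᶜ = 0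
    simp only [Measure.coe_finsetSum, Finset.sum_apply, Measure.smul_apply, smul_eq_mul]
    refine Finset.sum_eq_zero fun i _ => ?_
    rw [Measure.dirac_apply' _ hK.compl, Set.indicator_of_notMem, mul_zero]
    simpa using hθ i
  rw [hres, integral_finsetSum_measure fun i _ =>
    (integrable_dirac (by simp)).smul_measure ENNReal.ofReal_ne_top]
  refine Finset.sum_congr rfl fun i _ => ?_
  rw [integral_smul_measure, integral_dirac, ENNReal.toReal_ofReal (ht i)]

lemma circleMoments_sum_smul_dirac {k : ℕ} {t : Fin k → ℝ} (ht : ∀ i, 0 ≤ t i) {θ : Fin k → ℂ}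
    (hθ : ∀ i, θ i ∈ Metric.sphere (0 : ℂ) 1) :
    circleMoments k (∑ i, ENNReal.ofReal (t i) • Measure.dirac (θ i)) =
      ∑ i, t i • momentCurve k (θ i) := by
  ext j
  rw [Finset.sum_apply]
  exact integral_sum_smul_dirac ht θ Metric.isClosed_sphere.measurableSet hθ _

lemma isFiniteMeasure_of_mem_circleBarycenters {k : ℕ} {σ : Measure ℂ}
    (hσ : σ ∈ circleBarycenters k) : IsFiniteMeasure σ := by
  obtain ⟨t, θ, ht0, ht1, hθ, rfl⟩ := hσ
  refine ⟨?_⟩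
  simp only [Measure.coe_finsetSum, Finset.sum_apply, Measure.smul_apply, smul_eq_mul,
    measure_univ, mul_one]
  exact ENNReal.sum_lt_top.2 fun i _ => ENNReal.ofReal_lt_top

lemma measureReal_eq_one_of_mem_circleBarycenters {k : ℕ} {σ : Measure ℂ}
    (hσ : σ ∈ circleBarycenters k) {K : Set ℂ} (hK : MeasurableSet K)
    (hSK : Metric.sphere (0 : ℂ) 1 ⊆ K) : σ.real K = 1 := by
  obtain ⟨t, θ, ht0, ht1, hθ, rfl⟩ := hσ
  have h := integral_sum_smul_dirac ht0 θ hK (fun i => hSK (hθ i)) fun _ => (1 : ℝ)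
  simpa [ht1] using h

lemma measure_singleton_zero_of_mem_circleBarycenters {k : ℕ} {σ : Measure ℂ}
    (hσ : σ ∈ circleBarycenters k) : σ {0} = 0 := by
  obtain ⟨t, θ, ht0, ht1, hθ, rfl⟩ := hσ
  simp only [Measure.coe_finsetSum, Finset.sum_apply, Measure.smul_apply, smul_eq_mul]
  refine Finset.sum_eq_zero fun i _ => ?_
  have : θ i ≠ 0 := fun h => by simpa [h] using hθ i
  simp [this]

lemma gauge_momentBody_circleMoments {k : ℕ} {σ : Measure ℂ} (hσ : σ ∈ circleBarycenters k) :
    gauge (momentBody k) (circleMoments k σ) = 1 := by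
  obtain ⟨t, θ, ht0, ht1, hθ, rfl⟩ := hσ
  rw [circleMoments_sum_smul_dirac ht0 hθ]
  exact gauge_momentBody_eq_one ht0 ht1 hθ

lemma mem_momentSphere_of_gauge_eq_one {k : ℕ} {c : Fin k → ℂ}
    (hc : gauge (momentBody k) c = 1) : c ∈ momentSphere k := by
  obtain ⟨t, θ, ht0, ht1, hθ, rfl⟩ := exists_of_gauge_momentBody_eq_one hc
  exact ⟨_, ⟨t, θ, ht0, ht1, hθ, rfl⟩, circleMoments_sum_smul_dirac ht0 hθ⟩

lemma integral_circleMoments_eq (k : ℕ) (ν : Measure ℂ) [IsFiniteMeasure ν] :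
    ∫ z in Metric.sphere (0 : ℂ) 1, momentCurve k z ∂ν = circleMoments k ν := by
  have hint : IntegrableOn (momentCurve k) (Metric.sphere (0 : ℂ) 1) ν :=
    (continuous_momentCurve k).continuousOn.integrableOn_compact (isCompact_sphere _ _)
  ext j
  exact ((ContinuousLinearMap.proj (R := ℝ) (φ := fun _ : Fin k => ℂ) j).integral_comp_comm
    hint).symm

lemma IsDiscDensity.isProbabilityMeasure {f : ℂ → ℝ} (hf : IsDiscDensity f) :
    IsProbabilityMeasure (discMeasure f) := by
  refine ⟨?_⟩
  rw [discMeasure, withDensity_apply _ MeasurableSet.univ, Measure.restrict_univ,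
    ← ofReal_integral_eq_lintegral_ofReal hf.1 hf.2.1, hf.2.2, ENNReal.ofReal_one]

lemma IsDiscDensity.setIntegral_eq {f : ℂ → ℝ} (hf : IsDiscDensity f) {U : Set ℂ}
    (hU : MeasurableSet U) : ∫ y in U ∩ Metric.ball 0 1, f y = (discMeasure f).real U := by
  rw [measureReal_def, discMeasure, withDensity_apply _ hU, Measure.restrict_restrict hU]
  have hle : volume.restrict (U ∩ Metric.ball (0 : ℂ) 1) ≤ volume.restrict (Metric.ball 0 1) :=
    Measure.restrict_mono Set.inter_subset_right le_rfl
  have h0 : 0 ≤ᵐ[volume.restrict (U ∩ Metric.ball (0 : ℂ) 1)] f := ae_mono hle hf.2.1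
  have hint : Integrable f (volume.restrict (U ∩ Metric.ball (0 : ℂ) 1)) :=
    hf.1.mono_set Set.inter_subset_right
  rw [← ofReal_integral_eq_lintegral_ofReal hint h0,
    ENNReal.toReal_ofReal (integral_nonneg_of_ae h0)]

lemma discMeasure_absolutelyContinuous (f : ℂ → ℝ) :
    discMeasure f ≪ volume.restrict (Metric.ball (0 : ℂ) 1) :=
  withDensity_absolutelyContinuous _ _

lemma discMeasure_singleton_zero (f : ℂ → ℝ) : discMeasure f {0} = 0 :=
  discMeasure_absolutelyContinuous f (Measure.restrict_le_self.absolutelyContinuous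
    (measure_singleton 0))

lemma discMeasure_restrict_closedBall (f : ℂ → ℝ) :
    (discMeasure f).restrict (Metric.closedBall 0 1) = discMeasure f := by
  refine Measure.restrict_eq_self_of_ae_mem ?_
  refine (discMeasure_absolutelyContinuous f).ae_le ?_
  filter_upwards [ae_restrict_mem measurableSet_ball] with z hz
  exact Metric.ball_subset_closedBall hz

lemma IsDiscDensity.measureReal_closedBall {f : ℂ → ℝ} (hf : IsDiscDensity f) :
    (discMeasure f).real (Metric.closedBall 0 1) = 1 := by
  have := hf.isProbabilityMeasure
  rw [measureReal_def, ← Measure.restrict_apply_self, discMeasure_restrict_closedBall]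
  rw [← Measure.restrict_apply_univ, discMeasure_restrict_closedBall, measure_univ,
    ENNReal.toReal_one]

lemma div_norm_mem_sphere {z : ℂ} (hz : z ≠ 0) : z / (‖z‖ : ℂ) ∈ Metric.sphere (0 : ℂ) 1 := by
  rw [mem_sphere_zero_iff_norm, norm_div, Complex.norm_real, norm_norm,
    div_self (norm_ne_zero_iff.2 hz)]

lemma IsDiscDensity.isProbabilityMeasure_angularMeasure {f : ℂ → ℝ} (hf : IsDiscDensity f) :
    IsProbabilityMeasure (angularMeasure f) := by
  have := hf.isProbabilityMeasure
  exact Measure.isProbabilityMeasure_map measurable_div_norm.aemeasurable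

lemma angularMeasure_restrict_sphere (f : ℂ → ℝ) :
    (angularMeasure f).restrict (Metric.sphere 0 1) = angularMeasure f := by
  refine Measure.restrict_eq_self_of_ae_mem ?_
  refine (ae_map_iff measurable_div_norm.aemeasurable
    Metric.isClosed_sphere.measurableSet).2 ?_
  have hne : ∀ᵐ z ∂(discMeasure f), z ≠ 0 := by
    rw [ae_iff]
    simpa using discMeasure_singleton_zero f
  filter_upwards [hne] with z hz
  exact div_norm_mem_sphere hz

lemma IsDiscDensity.measureReal_angularMeasure_sphere {f : ℂ → ℝ} (hf : IsDiscDensity f) :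
    (angularMeasure f).real (Metric.sphere 0 1) = 1 := by
  have := hf.isProbabilityMeasure_angularMeasure
  rw [measureReal_def, ← Measure.restrict_apply_univ, angularMeasure_restrict_sphere, measure_univ,
    ENNReal.toReal_one]

lemma circleMoments_angularMeasure (k : ℕ) (f : ℂ → ℝ) (j : Fin k) :
    circleMoments k (angularMeasure f) j =
      ∫ z in Metric.closedBall (0 : ℂ) 1, (z / (‖z‖ : ℂ)) ^ (j.val + 1) ∂(discMeasure f) := by
  rw [circleMoments, angularMeasure_restrict_sphere, discMeasure_restrict_closedBall,
    angularMeasure, integral_map measurable_div_norm.aemeasurable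
      (by fun_prop : Continuous fun z : ℂ => z ^ (j.val + 1)).aestronglyMeasurable]

/-! ### Moments of concentrated densities do not vanish -/

/-- A measure on the circle that has almost all its mass near `k` points has a nonzero moment vector:
the squared modulus of the polynomial with zeros at these points has a small integral, whereas the
integral would be at least `1` if the moments vanished. -/
lemma circleMoments_ne_zero {k : ℕ} {ν : Measure ℂ} [IsFiniteMeasure ν]
    (hν : ν.real (Metric.sphere (0 : ℂ) 1) = 1) {θ : Fin k → ℂ} (hθ : ∀ i, ‖θ i‖ = 1) {ρ τ : ℝ}
    (hρ : ρ * 2 ^ k ≤ 1 / 2) (hτ : τ * 4 ^ k ≤ 1 / 2)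
    (hconc : 1 - τ < ν.real (Metric.sphere (0 : ℂ) 1 ∩ ⋃ i, Metric.closedBall (θ i) ρ)) :
    circleMoments k ν ≠ 0 := by
  intro h0
  obtain ⟨A, L, hA, hL⟩ := exists_affine_prod_norm_sub θ
  set S := Metric.sphere (0 : ℂ) 1 with hS
  set V := ⋃ i, Metric.closedBall (θ i) ρ with hV
  have hSm : MeasurableSet S := Metric.isClosed_sphere.measurableSet
  have hVm : MeasurableSet V := MeasurableSet.iUnion fun i => measurableSet_closedBall
  let p : ℂ → ℝ := fun z => (∏ i, ‖z - θ i‖) ^ 2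
  have hpc : Continuous p := by fun_prop
  have hpi : IntegrableOn p S ν := hpc.continuousOn.integrableOn_compact (isCompact_sphere _ _)
  have hγi : IntegrableOn (momentCurve k) S ν :=
    (continuous_momentCurve k).continuousOn.integrableOn_compact (isCompact_sphere _ _)
  have hintp : ∫ z in S, p z ∂ν = A := by
    have h1 : ∫ z in S, p z ∂ν = ∫ z in S, (A + L (momentCurve k z)) ∂ν :=
      setIntegral_congr_fun hSm fun z hz => hL z (by simpa [hS] using hz)
    rw [h1, integral_add (integrable_const _) (L.integrable_comp hγi), L.integral_comp_comm hγi,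
      hS, integral_circleMoments_eq, h0, map_zero, setIntegral_const, hν, one_smul, add_zero]
  have hdist (z : ℂ) (hz : z ∈ S) (i : Fin k) : ‖z - θ i‖ ≤ 2 := by
    refine (norm_sub_le _ _).trans ?_
    rw [hθ, mem_sphere_zero_iff_norm.1 hz]
    norm_num
  have hbig (z : ℂ) (hz : z ∈ S) : p z ≤ 4 ^ k := by
    have h1 : ∏ i, ‖z - θ i‖ ≤ 2 ^ k := by
      refine (Finset.prod_le_prod (fun i _ => norm_nonneg _) fun i _ => hdist z hz i).trans_eq ?_
      simp
    calc p z ≤ (2 ^ k) ^ 2 := pow_le_pow_left₀ (by positivity) h1 2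
      _ = 4 ^ k := by rw [← pow_mul, mul_comm, pow_mul]; norm_num
  have hsmall (z : ℂ) (hz : z ∈ S ∩ V) : p z ≤ 1 / 16 := by
    obtain ⟨i, hi⟩ := Set.mem_iUnion.1 hz.2
    rw [mem_closedBall_iff_norm] at hi
    have h1 : ∏ j, ‖z - θ j‖ ≤ 1 / 4 := by
      rw [← Finset.mul_prod_erase _ _ (Finset.mem_univ i)]
      have h2 : ∏ j ∈ Finset.univ.erase i, ‖z - θ j‖ ≤ 2 ^ (k - 1) := by
        refine (Finset.prod_le_prod (fun j _ => norm_nonneg _)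
          fun j _ => hdist z hz.1 j).trans_eq ?_
        simp
      have hk : k - 1 + 1 = k := Nat.sub_add_cancel i.pos
      have h3 : ‖z - θ i‖ * ∏ j ∈ Finset.univ.erase i, ‖z - θ j‖ ≤ ρ * 2 ^ (k - 1) :=
        mul_le_mul hi h2 (by positivity) ((norm_nonneg _).trans hi)
      rw [← hk, pow_succ] at hρ
      linarith
    calc p z ≤ (1 / 4) ^ 2 := pow_le_pow_left₀ (by positivity) h1 2
      _ = 1 / 16 := by norm_num
  have hsplit : ∫ z in S, p z ∂ν = (∫ z in S ∩ V, p z ∂ν) + ∫ z in S \ V, p z ∂ν :=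
    (integral_inter_add_sdiff hVm hpi).symm
  have hm : ν.real (S ∩ V) + ν.real (S \ V) = 1 := by
    rw [measureReal_inter_add_sdiff hVm, hν]
  have hle1 : ∫ z in S ∩ V, p z ∂ν ≤ 1 / 16 * ν.real (S ∩ V) := by
    have := setIntegral_mono_on (hpi.mono_set Set.inter_subset_left) (integrableOn_const
      (measure_ne_top _ _)) (hSm.inter hVm) hsmall
    rwa [setIntegral_const, smul_eq_mul, mul_comm] at this
  have hle2 : ∫ z in S \ V, p z ∂ν ≤ 4 ^ k * ν.real (S \ V) := by
    have := setIntegral_mono_on (hpi.mono_set Set.sdiff_subset) (integrableOn_const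
      (measure_ne_top _ _)) (hSm.diff hVm) fun z hz => hbig z hz.1
    rwa [setIntegral_const, smul_eq_mul, mul_comm] at this
  have h4 : (4 : ℝ) ^ k * ν.real (S \ V) ≤ 4 ^ k * τ :=
    mul_le_mul_of_nonneg_left (by linarith) (by positivity)
  have h5 : ν.real (S ∩ V) ≤ 1 := by linarith [measureReal_nonneg (μ := ν) (s := S \ V)]
  linarith

/-- Radial projection to the unit circle maps a disc of centre `x` and radius `δ |x|` into the disc of
centre `x / |x|` and radius `2 δ`. -/
lemma norm_div_norm_sub_le {x z : ℂ} (hx : x ≠ 0) (hz : z ≠ 0) {δ : ℝ} (h : ‖z - x‖ ≤ δ * ‖x‖) :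
    ‖z / (‖z‖ : ℂ) - x / (‖x‖ : ℂ)‖ ≤ 2 * δ := by
  have hx' : 0 < ‖x‖ := norm_pos_iff.2 hx
  have hz' : 0 < ‖z‖ := norm_pos_iff.2 hz
  have hxC : (‖x‖ : ℂ) ≠ 0 := Complex.ofReal_ne_zero.2 hx'.ne'
  have hzC : (‖z‖ : ℂ) ≠ 0 := Complex.ofReal_ne_zero.2 hz'.ne'
  have heq : z / (‖z‖ : ℂ) - x / (‖x‖ : ℂ) =
      z / ‖z‖ * (((‖x‖ - ‖z‖ : ℝ) : ℂ) / ‖x‖) + (z - x) / ‖x‖ := by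
    push_cast
    field_simp
    ring
  have h1 : |‖x‖ - ‖z‖| ≤ δ * ‖x‖ := by
    refine (abs_norm_sub_norm_le x z).trans ?_
    rwa [norm_sub_rev]
  have h2 : |‖x‖ - ‖z‖| / ‖x‖ ≤ δ := (div_le_iff₀ hx').2 h1
  have h3 : ‖z - x‖ / ‖x‖ ≤ δ := (div_le_iff₀ hx').2 h
  rw [heq]
  refine (norm_add_le _ _).trans ?_
  simp only [norm_mul, norm_div, Complex.norm_real, norm_norm, div_self hz'.ne']
  rw [Real.norm_eq_abs]
  linarith

lemma circleMoments_angularMeasure_ne_zero {k : ℕ} {δ τ : ℝ}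
    (hδ : δ * 2 ^ k ≤ 1 / 4) (hτ : τ * 4 ^ k ≤ 1 / 2) {f : ℂ → ℝ}
    (hf : f ∈ concentratedDensities k δ τ) : circleMoments k (angularMeasure f) ≠ 0 := by
  obtain ⟨hfd, hJ⟩ := hf
  have := hfd.isProbabilityMeasure
  have := hfd.isProbabilityMeasure_angularMeasure
  have hne : Nonempty {x : Fin k → ℂ // ∀ i, x i ≠ 0} := ⟨⟨fun _ => 1, fun _ => one_ne_zero⟩⟩
  obtain ⟨⟨x, hx⟩, hxJ⟩ := exists_lt_of_lt_ciSup hJ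
  rw [hfd.setIntegral_eq (MeasurableSet.iUnion fun i => measurableSet_ball)] at hxJ
  refine circleMoments_ne_zero hfd.measureReal_angularMeasure_sphere
    (θ := fun i => x i / (‖x i‖ : ℂ)) (ρ := 2 * δ)
    (fun i => by simpa using div_norm_mem_sphere (hx i)) (by linarith) hτ (hxJ.trans_le ?_)
  rw [measureReal_def, measureReal_def, angularMeasure, Measure.map_apply measurable_div_norm
    (Metric.isClosed_sphere.measurableSet.inter
      (MeasurableSet.iUnion fun i => measurableSet_closedBall))]
  refine ENNReal.toReal_mono (measure_ne_top _ _) (measure_mono_ae ?_)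
  have hne0 : ∀ᵐ z ∂(discMeasure f), z ≠ 0 := by
    rw [ae_iff]
    simpa using discMeasure_singleton_zero f
  filter_upwards [hne0] with z hz hzU
  obtain ⟨i, hi⟩ := Set.mem_iUnion.1 hzU
  refine ⟨div_norm_mem_sphere hz, Set.mem_iUnion.2 ⟨i, ?_⟩⟩
  rw [mem_closedBall_iff_norm]
  exact norm_div_norm_sub_le (hx i) hz (mem_ball_iff_norm.1 hi).le

/-! ### The retraction -/

/-- The radial projection `c ↦ c / g(c)` to the boundary of the convex hull of the moment curve, where
`g` is the Minkowski functional of this convex body. -/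
noncomputable def momentRetraction (k : ℕ) (c : Fin k → ℂ) : Fin k → ℂ :=
  (gauge (momentBody k) c)⁻¹ • c

lemma gauge_momentBody_pos {k : ℕ} {c : Fin k → ℂ} (hc : c ≠ 0) : 0 < gauge (momentBody k) c :=
  (gauge_pos (absorbent_nhds_zero (momentBody_mem_nhds_zero k))
    (NormedSpace.isVonNBounded_of_isBounded ℝ (isCompact_momentBody k).isBounded)).2 hc

lemma momentRetraction_mem_momentSphere {k : ℕ} {c : Fin k → ℂ} (hc : c ≠ 0) :
    momentRetraction k c ∈ momentSphere k := by
  have h := gauge_momentBody_pos hc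
  apply mem_momentSphere_of_gauge_eq_one
  rw [momentRetraction, gauge_smul_of_nonneg (inv_nonneg.2 h.le), smul_eq_mul,
    inv_mul_cancel₀ h.ne']

lemma continuousAt_momentRetraction {k : ℕ} {c : Fin k → ℂ} (hc : c ≠ 0) :
    ContinuousAt (momentRetraction k) c :=
  ((continuous_gauge (convex_momentBody k) (momentBody_mem_nhds_zero k)).continuousAt.inv₀
    (gauge_momentBody_pos hc).ne').smul continuousAt_id

lemma tendsto_momentRetraction_circleMoments {k : ℕ} {σ : Measure ℂ}
    (hσ : σ ∈ circleBarycenters k) :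
    Tendsto (momentRetraction k) (𝓝 (circleMoments k σ)) (𝓝 (circleMoments k σ)) := by
  have h1 := gauge_momentBody_circleMoments hσ
  have hne : circleMoments k σ ≠ 0 := by
    intro h
    rw [h, gauge_zero] at h1
    exact zero_ne_one h1
  have h := continuousAt_momentRetraction hne
  rwa [ContinuousAt, momentRetraction, h1, inv_one, one_smul] at h

lemma tendsto_circleMoments_of_discMeasure {k : ℕ} {ι : Type*} {l : Filter ι} {f : ι → ℂ → ℝ}
    (hf : ∀ i, IsDiscDensity (f i)) {ν : Measure ℂ} [IsFiniteMeasure ν]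
    (hν : ν.real (Metric.closedBall 0 1) = 1) (hν0 : ν {0} = 0)
    (h : Tendsto (fun i => kantorovichRubinsteinDist (Metric.closedBall 0 1)
      (discMeasure (f i)) ν) l (𝓝 0)) :
    Tendsto (fun i => circleMoments k (angularMeasure (f i))) l (𝓝 fun j : Fin k =>
      ∫ z in Metric.closedBall (0 : ℂ) 1, (z / (‖z‖ : ℂ)) ^ (j.val + 1) ∂ν) := by
  have := fun i => (hf i).isProbabilityMeasure
  rw [tendsto_pi_nhds]
  intro j
  simp only [circleMoments_angularMeasure]
  exact tendsto_angular_moment (isCompact_closedBall 0 1)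
    (fun i => (hf i).measureReal_closedBall) hν hν0 h _

lemma integral_angular_pow_eq_circleMoments {k : ℕ} {σ : Measure ℂ}
    (hσ : σ ∈ circleBarycenters k) (j : Fin k) :
    ∫ z in Metric.closedBall (0 : ℂ) 1, (z / (‖z‖ : ℂ)) ^ (j.val + 1) ∂σ =
      circleMoments k σ j := by
  obtain ⟨t, θ, ht0, ht1, hθ, rfl⟩ := hσ
  rw [circleMoments_sum_smul_dirac ht0 hθ, integral_sum_smul_dirac ht0 θ measurableSet_closedBall
    (fun i => Metric.sphere_subset_closedBall (hθ i)), Finset.sum_apply]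
  refine Finset.sum_congr rfl fun i _ => ?_
  rw [mem_sphere_zero_iff_norm.1 (hθ i), Complex.ofReal_one, div_one]
  rfl

lemma tendsto_circleMoments_of_angularMeasure {k : ℕ} {ι : Type*} {l : Filter ι} {f : ι → ℂ → ℝ}
    (hf : ∀ i, IsDiscDensity (f i)) {σ : Measure ℂ} (hσ : σ ∈ circleBarycenters k)
    (h : Tendsto (fun i => kantorovichRubinsteinDist (Metric.sphere 0 1)
      (angularMeasure (f i)) σ) l (𝓝 0)) :
    Tendsto (fun i => circleMoments k (angularMeasure (f i))) l (𝓝 (circleMoments k σ)) := by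
  have := fun i => (hf i).isProbabilityMeasure_angularMeasure
  have := isFiniteMeasure_of_mem_circleBarycenters hσ
  rw [tendsto_pi_nhds]
  intro j
  rw [tendsto_iff_norm_sub_tendsto_zero]
  have h1 := h.const_mul (2 * ((j.val + 1 : ℕ) : ℝ))
  rw [mul_zero] at h1
  refine squeeze_zero (fun _ => norm_nonneg _) (fun i => ?_) h1
  refine norm_integral_sub_le_mul_kantorovichRubinsteinDist (isCompact_sphere 0 1)
    (hf i).measureReal_angularMeasure_sphere
    (measureReal_eq_one_of_mem_circleBarycenters hσ Metric.isClosed_sphere.measurableSet subset_rfl)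
    (Nat.cast_pos.2 j.val.succ_pos) fun x hx y hy => ?_
  exact norm_pow_sub_pow_le_mul (mem_sphere_zero_iff_norm.1 hx).le
    (mem_sphere_zero_iff_norm.1 hy).le _

theorem proposition3p1 (k : ℕ) (hk : 1 ≤ k) :
    ∃ δk τk : ℝ, 0 < δk ∧ 0 < τk ∧ ∀ δ : ℝ, 0 < δ → δ ≤ δk →
      ∃ Ξ : concentratedDensities k δ τk → momentSphere k,
        -- continuity for the Kantorovich–Rubinstein distance on the (closed) disc
        (∀ f : concentratedDensities k δ τk, ∀ ε > 0, ∃ η > 0,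
          ∀ g : concentratedDensities k δ τk,
            kantorovichRubinsteinDist (Metric.closedBall 0 1)
              (discMeasure g.1) (discMeasure f.1) < η →
            dist (Ξ g) (Ξ f) < ε) ∧
        -- behaviour when the measures `f_n dx` converge, on the closed disc, to `σ ∈ (S¹)_k`
        (∀ (f : ℕ → concentratedDensities k δ τk), ∀ σ ∈ circleBarycenters k,
          Tendsto (fun n => kantorovichRubinsteinDist (Metric.closedBall 0 1)
            (discMeasure (f n).1) σ) atTop (𝓝 0) →
          Tendsto (fun n => (Ξ (f n) : Fin k → ℂ)) atTop (𝓝 (circleMoments k σ))) ∧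
        -- the same when only the angular measures converge, on the circle, to `σ ∈ (S¹)_k`
        (∀ (f : ℕ → concentratedDensities k δ τk), ∀ σ ∈ circleBarycenters k,
          Tendsto (fun n => kantorovichRubinsteinDist (Metric.sphere 0 1)
            (angularMeasure (f n).1) σ) atTop (𝓝 0) →
          Tendsto (fun n => (Ξ (f n) : Fin k → ℂ)) atTop (𝓝 (circleMoments k σ))) := by
  have hτ : 1 / (2 * 4 ^ k) * (4 : ℝ) ^ k ≤ 1 / 2 := by
    rw [div_mul_eq_mul_div, one_mul, div_le_div_iff₀ (by positivity) two_pos]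
    linarith
  refine ⟨1 / (4 * 2 ^ k), 1 / (2 * 4 ^ k), by positivity, by positivity, fun δ _ hδ => ?_⟩
  have hδ' : δ * 2 ^ k ≤ 1 / 4 := by
    rw [le_div_iff₀ (by positivity)] at hδ
    linarith
  have hne (f : concentratedDensities k δ (1 / (2 * 4 ^ k))) :
      circleMoments k (angularMeasure f.1) ≠ 0 :=
    circleMoments_angularMeasure_ne_zero hδ' hτ f.2
  refine ⟨fun f => ⟨momentRetraction k (circleMoments k (angularMeasure f.1)),
    momentRetraction_mem_momentSphere (hne f)⟩, fun f ε hε => ?_, fun f σ hσ h => ?_,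
    fun f σ hσ h => ?_⟩
  · have := f.2.1.isProbabilityMeasure
    let D : concentratedDensities k δ (1 / (2 * 4 ^ k)) → ℝ := fun g =>
      kantorovichRubinsteinDist (Metric.closedBall 0 1) (discMeasure g.1) (discMeasure f.1)
    have hlim := tendsto_circleMoments_of_discMeasure (k := k) (l := comap D (𝓝 0))
      (f := fun g : concentratedDensities k δ (1 / (2 * 4 ^ k)) => g.1) (fun g => g.2.1)
      f.2.1.measureReal_closedBall (discMeasure_singleton_zero f.1) tendsto_comap
    simp only [← circleMoments_angularMeasure] at hlim
    have hΞ := Metric.tendsto_nhds.1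
      ((continuousAt_momentRetraction (hne f)).tendsto.comp hlim) ε hε
    obtain ⟨η, hη, hball⟩ := (Metric.nhds_basis_ball.comap D).eventually_iff.1 hΞ
    refine ⟨η, hη, fun g hg => hball ?_⟩
    rw [Set.mem_preimage, mem_ball_zero_iff, Real.norm_eq_abs,
      abs_of_nonneg (kantorovichRubinsteinDist_nonneg _ _ _)]
    exact hg
  · have := isFiniteMeasure_of_mem_circleBarycenters hσ
    have hlim := tendsto_circleMoments_of_discMeasure (k := k) (fun n => (f n).2.1)
      (measureReal_eq_one_of_mem_circleBarycenters hσ measurableSet_closedBall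
        Metric.sphere_subset_closedBall)
      (measure_singleton_zero_of_mem_circleBarycenters hσ) h
    simp only [integral_angular_pow_eq_circleMoments hσ] at hlim
    exact (tendsto_momentRetraction_circleMoments hσ).comp hlim
  · exact (tendsto_momentRetraction_circleMoments hσ).comp
      (tendsto_circleMoments_of_angularMeasure (fun n => (f n).2.1) hσ h)
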